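/- **Theorem 3.8.** Let $R$ be a local ring (with identity, not necessarily commutative), $J=J(R)$ its Jacobson radical and $Z(R)$ its centre. Let $M$ be a finitely generated semisimple left $R$-module and let $\varphi\in\mathrm{End}_R(M)$ be nilpotent of index $n$, i.e. $n$ is the least exponent with $\varphi^n=0$. Let $X=\{x_{\gamma,i}\mid 1\le\gamma\le m,\ 1\le i\le k_\gamma\}\subseteq M$ be a nilpotent Jordan normal base of $M$ with respect to $\varphi$, that is: each $Rx_{\gamma,i}$ is a simple submodule, $M=\bigoplus_{\gamma,i}Rx_{\gamma,i}$, $\varphi(x_{\gamma,i})=x_{\gamma,i+1}$ for $i<k_\gamma$ and $\varphi(x_{\gamma,k_\gamma})=0$, with the blocks ordered so that $k_1\ge k_2\ge\cdots\ge k_m\ge1$. Let $$\mathcal U_0(X)=\{[u_{\delta,\gamma}]\in \mathrm M_m(R/J)\mid u_{\delta,\gamma}=0 \text{ whenever } k_\delta<k_\gamma\text{ or }k_\gamma=1\},$$ a block upper triangular $Z(R)$-subalgebra of $\mathrm M_m(R/J)$ (not necessarily containing the unit matrix). Write $$\mathrm{Cen}(\varphi)=\{\psi\in\mathrm{End}_R(M)\mid\psi\varphi=\varphi\psi\},\qquad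 \mathrm{Cen}_0(\varphi)=\{\psi\in\mathrm{End}_R(M)\mid\psi\varphi=\varphi\psi=0\};$$ here $\mathrm{Cen}(\varphi)$ is a $Z(R)$-algebra and $\mathrm{Cen}_0(\varphi)$ is a two-sided ideal of it. Let $f_1,\ldots,f_{n-1}\in Z(R)\langle x_1,\ldots,x_r\rangle$ be polynomials in noncommuting variables such that each $f_i=0$ is a polynomial identity of the subalgebra $\mathcal U_0(X)$ of the opposite algebra $\mathrm M_m^{\mathrm{op}}(R/J)$, i.e. $f_i(U_1,\ldots,U_r)=0$, evaluated in $\mathrm M_m^{\mathrm{op}}(R/J)$, for all $U_1,\ldots,U_r\in\mathcal U_0(X)$. Then $f_1f_2\cdots f_{n-1}=0$ is a polynomial identity of the factor algebra $\mathrm{Cen}(\varphi)/\mathrm{Cen}_0(\varphi)$ (for $n\le1$ there are no polynomials $f_i$ and the empty product is $1$). -/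

import Mathlib

noncomputable section

namespace ZeroLevel

universe u v w

/-- The centre `Z(R)` of the ring `R`, a commutative ring. -/
abbrev Centre (R : Type u) [Ring R] : Type u := Subring.center R

/-- The factor ring `R/J`, where `J` is the Jacobson radical of `R`. -/
abbrev ResidueRing (R : Type u) [Ring R] : Type u := R ⧸ Ring.jacobson R

/-- Let `C` be a commutative ring, `A` a `C`-algebra and `S ⊆ A` (typically a subalgebra which
need not contain the unit of `A`). The noncommutative polynomial `f ∈ C⟨x_i : i ∈ X⟩` is a
polynomial identity of `S` if `f` vanishes under every substitution of elements of `S` for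
the variables. -/
def IsPolynomialIdentity {C : Type u} [CommRing C] {A : Type v} [Ring A] [Algebra C A]
    {X : Type w} (S : Set A) (f : FreeAlgebra C X) : Prop :=
  ∀ v : X → A, (∀ i, v i ∈ S) → FreeAlgebra.lift C v f = 0

section Module

variable {R : Type u} [Ring R] {M : Type v} [AddCommGroup M] [Module R M]

/-- The centralizer `Cen(φ) = {ψ | ψφ = φψ}`, a `Z(R)`-subalgebra of `End_R(M)`. -/
abbrev Cen (φ : Module.End R M) : Subalgebra (Centre R) (Module.End R M) :=
  Subalgebra.centralizer (Centre R) {φ}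

/-- The zero-level centralizer `Cen₀(φ) = {ψ | ψφ = φψ = 0}`, as an ideal of `Cen(φ)`. -/
def Cen₀ (φ : Module.End R M) : Ideal (Cen φ) where
  carrier := {ψ | (ψ : Module.End R M) * φ = 0 ∧ φ * (ψ : Module.End R M) = 0}
  add_mem' := by
    rintro a b ⟨ha, ha'⟩ ⟨hb, hb'⟩
    change ((a : Module.End R M) + b) * φ = 0 ∧ φ * ((a : Module.End R M) + b) = 0
    rw [add_mul, mul_add, ha, ha', hb, hb', add_zero]
    exact ⟨rfl, rfl⟩
  zero_mem' := by simp
  smul_mem' := by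
    rintro c a ⟨ha, ha'⟩
    have hc : φ * (c : Module.End R M) = c * φ :=
      Subalgebra.mem_centralizer_iff _ |>.1 c.2 φ rfl
    change ((c : Module.End R M) * a) * φ = 0 ∧ φ * ((c : Module.End R M) * a) = 0
    rw [mul_assoc, ha, mul_zero, ← mul_assoc, hc, mul_assoc, ha', mul_zero]
    exact ⟨rfl, rfl⟩

/-- `Cen₀(φ)` is a two-sided ideal, so that the factor `Cen(φ)/Cen₀(φ)` is a `Z(R)`-algebra. -/
instance (φ : Module.End R M) : (Cen₀ φ).IsTwoSided where
  mul_mem_of_left := by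
    rintro a b ⟨ha, ha'⟩
    have hb : φ * (b : Module.End R M) = b * φ :=
      Subalgebra.mem_centralizer_iff _ |>.1 b.2 φ rfl
    refine ⟨?_, ?_⟩
    · rw [Subalgebra.coe_mul, mul_assoc, ← hb, ← mul_assoc, ha, zero_mul]
    · rw [Subalgebra.coe_mul, ← mul_assoc, ha', zero_mul]

/-- A nilpotent Jordan normal base `{x_{γ,i} | γ ∈ Γ, 1 ≤ i ≤ k_γ}` of `M` with respect to `φ`.
The second index is counted from `0` here, that is, `x γ i` for `0 ≤ i < k γ`. -/
structure NilpotentJordanBase (φ : Module.End R M) (Γ : Type w) where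
  /-- the block sizes `k_γ` -/
  k : Γ → ℕ
  k_pos : ∀ γ, 1 ≤ k γ
  k_bounded : BddAbove (Set.range k)
  /-- the elements of the base -/
  x : (γ : Γ) → Fin (k γ) → M
  simple : ∀ γ i, IsSimpleModule R (Submodule.span R {x γ i})
  /-- the sum of the submodules `R x_{γ,i}` is direct ... -/
  independent : iSupIndep fun p : (γ : Γ) × Fin (k γ) => Submodule.span R {x p.1 p.2}
  /-- ... and equal to `M` -/
  iSup_eq_top : ⨆ p : (γ : Γ) × Fin (k γ), Submodule.span R {x p.1 p.2} = ⊤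
  map_next : ∀ γ (i : ℕ) (h : i + 1 < k γ), φ (x γ ⟨i, Nat.lt_of_succ_lt h⟩) = x γ ⟨i + 1, h⟩
  map_last : ∀ γ (i : Fin (k γ)), (i : ℕ) + 1 = k γ → φ (x γ i) = 0

/-- The matrices `[u_{δ,γ}]` over `R/J` with `u_{δ,γ} = 0` if `k_δ < k_γ` or `k_γ = 1`.
They form a (block upper triangular, for decreasing block sizes) `Z(R)`-subalgebra
`𝒰₀(X)` of `M_m(R/J)`, which contains the unit matrix only if all block sizes are at least 2. -/
def U₀ {φ : Module.End R M} {m : ℕ} (X : NilpotentJordanBase φ (Fin m)) :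
    NonUnitalSubalgebra (Centre R) (Matrix (Fin m) (Fin m) (ResidueRing R)) where
  carrier := {U | ∀ δ γ, X.k δ < X.k γ ∨ X.k γ = 1 → U δ γ = 0}
  add_mem' := by
    intro a b ha hb δ γ h
    rw [Matrix.add_apply, ha δ γ h, hb δ γ h, add_zero]
  zero_mem' := fun _ _ _ => rfl
  mul_mem' := by
    intro a b ha hb δ γ h
    rw [Matrix.mul_apply]
    refine Finset.sum_eq_zero fun τ _ => ?_
    by_cases h1 : X.k τ < X.k γ ∨ X.k γ = 1
    · rw [hb τ γ h1, mul_zero]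
    · rw [ha δ τ (Or.inl (by omega)), zero_mul]
  smul_mem' := by
    intro c a ha δ γ h
    rw [Matrix.smul_apply, ha δ γ h, smul_zero]

/-- `𝒰₀(X)` as a subset of the opposite matrix algebra `M_m^op(R/J)`. -/
def U₀op {φ : Module.End R M} {m : ℕ} (X : NilpotentJordanBase φ (Fin m)) :
    Set (Matrix (Fin m) (Fin m) (ResidueRing R))ᵐᵒᵖ :=
  {U | U.unop ∈ U₀ X}

end Module

end ZeroLevel

end

namespace ZeroLevel

section Module

variable {R : Type*} [Ring R] {M : Type*} [AddCommGroup M] [Module R M] {φ : Module.End R M}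

/-! Put N = ker φ + im φ. Every ψ in Cen(φ) preserves N, and modulo N the module is generated by the
block heads, those of blocks of size 1 being zero. So ψ acts on M/N by a matrix, which can be chosen
in `U₀op X`; composition reverses matrix products, whence the opposite algebra. A polynomial
vanishing on these matrices therefore takes values in Cen(φ) that send M into N
(`apply_mem_of_represents_zero`). Each such value gains one power of φ: a product of n - 1 of them,
followed by φ, lands in im φ^n = 0 (`prod_apply_mem_range_pow`). Hence the product lies in Cen₀(φ).
-/

/-- The sum `ker φ + im φ`. -/
def kerSupRange (φ : Module.End R M) : Submodule R M := LinearMap.ker φ ⊔ LinearMap.range φ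

/-! ### Centralizer elements and ker φ + im φ -/

lemma apply_comm_of_mem_cen {ψ : Module.End R M} (hψ : ψ ∈ Cen φ) (y : M) :
    φ (ψ y) = ψ (φ y) :=
  LinearMap.congr_fun ((Subalgebra.mem_centralizer_iff _).1 hψ φ rfl) y

lemma pow_apply_comm_of_mem_cen {ψ : Module.End R M} (hψ : ψ ∈ Cen φ) (k : ℕ) (y : M) :
    (φ ^ k) (ψ y) = ψ ((φ ^ k) y) := by
  have h : Commute φ ψ := (Subalgebra.mem_centralizer_iff _).1 hψ φ rfl
  exact LinearMap.congr_fun (h.pow_left k).eq y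

lemma apply_mem_kerSupRange {ψ : Module.End R M} (hψ : ψ ∈ Cen φ) {y : M}
    (hy : y ∈ kerSupRange φ) : ψ y ∈ kerSupRange φ := by
  obtain ⟨a, ha, b, ⟨z, rfl⟩, rfl⟩ := Submodule.mem_sup.1 hy
  rw [map_add]
  refine Submodule.add_mem_sup ?_ ⟨ψ z, apply_comm_of_mem_cen hψ z⟩
  rw [LinearMap.mem_ker] at ha ⊢
  rw [apply_comm_of_mem_cen hψ, ha, map_zero]

/-- If φ(L y) = φ^(l+1) z and g z = a + φ t with φ a = 0, then φ(g L y) = φ^(l+1)(g z) = φ^(l+2) t: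
the exponent is at least 1, so a disappears. -/
lemma prod_apply_mem_range_pow (L : List (Cen φ))
    (hL : ∀ g ∈ L, ∀ y, (g : Module.End R M) y ∈ kerSupRange φ) (y : M) :
    φ ((L.prod : Module.End R M) y) ∈ LinearMap.range (φ ^ (L.length + 1)) := by
  induction L generalizing y with
  | nil => exact ⟨y, by simp⟩
  | cons g L ih =>
    obtain ⟨z, hz⟩ := ih (fun a ha => hL a (List.mem_cons_of_mem _ ha)) y
    obtain ⟨a, ha, b, ⟨t, rfl⟩, hab⟩ := Submodule.mem_sup.1 (hL g List.mem_cons_self z)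
    refine ⟨t, ?_⟩
    have hφ : φ ((g : Module.End R M) z) = φ (φ t) := by
      rw [← hab, map_add, LinearMap.mem_ker.1 ha, zero_add]
    rw [List.prod_cons, Subalgebra.coe_mul, Module.End.mul_apply, apply_comm_of_mem_cen g.2, ← hz,
      ← pow_apply_comm_of_mem_cen g.2, List.length_cons, pow_succ φ (L.length + 1),
      pow_succ φ L.length, Module.End.mul_apply, Module.End.mul_apply, Module.End.mul_apply, hφ]

lemma mem_Cen₀_of_mul_eq_zero {ψ : Cen φ} (h : φ * (ψ : Module.End R M) = 0) : ψ ∈ Cen₀ φ := by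
  refine ⟨?_, h⟩
  have h' : φ * (ψ : Module.End R M) = ψ * φ := (Subalgebra.mem_centralizer_iff _).1 ψ.2 φ rfl
  rw [← h', h]

/-! ### Coefficients with respect to a Jordan base -/

namespace NilpotentJordanBase

variable {m : ℕ} (X : NilpotentJordanBase φ (Fin m))

/-- The first element of a block. -/
def head (γ : Fin m) : M := X.x γ ⟨0, X.k_pos γ⟩

lemma pow_apply (γ : Fin m) (j i : ℕ) (hi : i < X.k γ) :
    (φ ^ j) (X.x γ ⟨i, hi⟩) = if h : i + j < X.k γ then X.x γ ⟨i + j, h⟩ else 0 := by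
  induction j with
  | zero => simp [hi]
  | succ j ih =>
    rw [pow_succ', Module.End.mul_apply, ih]
    by_cases h : i + j < X.k γ
    · rw [dif_pos h]
      by_cases h' : i + (j + 1) < X.k γ
      · rw [dif_pos h']
        exact X.map_next γ (i + j) h'
      · rw [dif_neg h']
        exact X.map_last γ _ (by simp only; omega)
    · rw [dif_neg h, dif_neg (by omega), map_zero]

lemma pow_head_eq_zero (γ : Fin m) : (φ ^ X.k γ) (X.head γ) = 0 := by
  rw [head, pow_apply, dif_neg (by omega)]

lemma x_ne_zero (γ : Fin m) (i : Fin (X.k γ)) : X.x γ i ≠ 0 := by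
  intro h
  have := X.simple γ i
  rw [isSimpleModule_iff_isAtom] at this
  exact this.1 (by rw [h, Submodule.span_zero_singleton])

lemma x_mem_kerSupRange (γ : Fin m) (i : Fin (X.k γ)) (hi : (i : ℕ) ≠ 0) :
    X.x γ i ∈ kerSupRange φ := by
  obtain ⟨i, h⟩ := i
  obtain _ | i := i
  · exact absurd rfl hi
  · exact Submodule.mem_sup_right ⟨_, X.map_next γ i h⟩

lemma head_mem_kerSupRange {γ : Fin m} (h : X.k γ = 1) : X.head γ ∈ kerSupRange φ :=
  Submodule.mem_sup_left (LinearMap.mem_ker.2 (X.map_last γ _ (by simp [h])))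

lemma span_range_eq_top :
    Submodule.span R (Set.range fun p : (γ : Fin m) × Fin (X.k γ) => X.x p.1 p.2) = ⊤ := by
  rw [← X.iSup_eq_top, Submodule.span_range_eq_iSup]

/-- By simplicity, φ^k is injective on R x as soon as it does not kill x. -/
lemma smul_eq_zero_of_pow_apply_eq_zero (γ : Fin m) (i : Fin (X.k γ)) {k : ℕ}
    (hk : (φ ^ k) (X.x γ i) ≠ 0) {c : R} (hc : c • (φ ^ k) (X.x γ i) = 0) :
    c • X.x γ i = 0 := by
  by_contra h
  have hs := X.simple γ i
  rw [isSimpleModule_iff_isAtom] at hs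
  have hle : Submodule.span R {c • X.x γ i} ≤ Submodule.span R {X.x γ i} :=
    Submodule.span_singleton_smul_le _ _ _
  have hker : Submodule.span R {c • X.x γ i} ≤ LinearMap.ker (φ ^ k) := by
    rw [Submodule.span_singleton_le_iff_mem, LinearMap.mem_ker, map_smul, hc]
  have heq := (hs.le_iff.1 hle).resolve_left (by rwa [Submodule.span_singleton_eq_bot])
  rw [heq, Submodule.span_singleton_le_iff_mem] at hker
  exact hk hker

/-- φ^k moves the head of δ to the base element at position k of its block, and every other base
element to 0 or to a different one; directness of the sum isolates the term. Coefficients are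
determined only up to annihilators, hence the form of the conclusion. -/
lemma smul_head_eq_zero {k : ℕ} (c : ((γ : Fin m) × Fin (X.k γ)) → R)
    (hc : (φ ^ k) (∑ p, c p • X.x p.1 p.2) = 0) (δ : Fin m) (hk : k < X.k δ) :
    c ⟨δ, ⟨0, X.k_pos δ⟩⟩ • X.head δ = 0 := by
  classical
  have hx : (φ ^ k) (X.x δ ⟨0, X.k_pos δ⟩) = X.x δ ⟨k, hk⟩ := by
    rw [pow_apply, dif_pos (by omega)]
    simp
  refine X.smul_eq_zero_of_pow_apply_eq_zero δ _ (k := k) (by rw [hx]; exact X.x_ne_zero _ _) ?_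
  rw [hx]
  refine Submodule.disjoint_def.1 (X.independent ⟨δ, ⟨k, hk⟩⟩) _
    (Submodule.smul_mem _ _ (Submodule.mem_span_singleton_self _)) ?_
  rw [← Finset.add_sum_erase _ _ (Finset.mem_univ ⟨δ, ⟨0, X.k_pos δ⟩⟩), map_add, map_smul, hx] at hc
  rw [eq_neg_of_add_eq_zero_left hc, map_sum]
  refine Submodule.neg_mem _ (Submodule.sum_mem _ fun p hp => ?_)
  rw [map_smul]
  refine Submodule.smul_mem _ _ ?_
  obtain ⟨γ, i, hi⟩ := p
  rw [pow_apply]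
  split_ifs with h
  · refine Submodule.mem_iSup_of_mem ⟨γ, ⟨i + k, h⟩⟩ (Submodule.mem_iSup_of_mem ?_
      (Submodule.mem_span_singleton_self _))
    rintro heq
    obtain ⟨rfl, h2⟩ := Sigma.mk.inj_iff.1 heq
    have h3 := Fin.mk.inj_iff.1 (eq_of_heq h2)
    obtain rfl : i = 0 := by omega
    exact (Finset.mem_erase.1 hp).1 rfl
  · exact Submodule.zero_mem _

/-! ### Matrices of centralizer elements modulo ker φ + im φ -/

/-- `ψ` acts on the heads of the blocks, modulo `ker φ + im φ`, through the rows of a lift to `R`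
of the matrix `U`. -/
def Represents (ψ : Module.End R M) (U : (Matrix (Fin m) (Fin m) (ResidueRing R))ᵐᵒᵖ) : Prop :=
  ∃ W : Matrix (Fin m) (Fin m) R, W.map (Ideal.Quotient.mk (Ring.jacobson R)) = U.unop ∧
    ∀ γ, ψ (X.head γ) - ∑ δ, W γ δ • X.head δ ∈ kerSupRange φ

variable {X}

lemma Represents.add {ψ ψ' : Module.End R M} {U U'} (h : X.Represents ψ U)
    (h' : X.Represents ψ' U') : X.Represents (ψ + ψ') (U + U') := by
  obtain ⟨W, hW, h⟩ := h
  obtain ⟨W', hW', h'⟩ := h'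
  refine ⟨W + W', ?_, fun γ => ?_⟩
  · rw [MulOpposite.unop_add, ← hW, ← hW']
    exact Matrix.map_add _ (map_add _) _ _
  · convert Submodule.add_mem _ (h γ) (h' γ) using 1
    simp only [Matrix.add_apply, add_smul, Finset.sum_add_distrib, LinearMap.add_apply]
    abel

lemma Represents.mul {ψ ψ' : Module.End R M} {U U'} (hψ : ψ ∈ Cen φ) (h : X.Represents ψ U)
    (h' : X.Represents ψ' U') : X.Represents (ψ * ψ') (U * U') := by
  obtain ⟨W, hW, h⟩ := h
  obtain ⟨W', hW', h'⟩ := h'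
  -- Scalars act on the left, so the coefficients of the inner map ψ' come first.
  refine ⟨W' * W, ?_, fun γ => ?_⟩
  · rw [MulOpposite.unop_mul, ← hW, ← hW', Matrix.map_mul]
  · have h1 := apply_mem_kerSupRange hψ (h' γ)
    have h2 : ∑ δ, W' γ δ • (ψ (X.head δ) - ∑ ε, W δ ε • X.head ε) ∈ kerSupRange φ :=
      Submodule.sum_mem _ fun δ _ => Submodule.smul_mem _ _ (h δ)
    convert Submodule.add_mem _ h1 h2 using 1
    simp only [Matrix.mul_apply, Finset.sum_smul, smul_sub, Finset.smul_sum, mul_smul, map_sub,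
      map_sum, map_smul, Finset.sum_sub_distrib, Module.End.mul_apply]
    rw [Finset.sum_comm]
    abel

lemma represents_algebraMap (X : NilpotentJordanBase φ (Fin m)) (c : Centre R) :
    X.Represents (algebraMap (Centre R) (Module.End R M) c) (algebraMap (Centre R) _ c) := by
  refine ⟨Matrix.diagonal fun _ => (c : R), ?_, fun γ => ?_⟩
  · rw [Matrix.diagonal_map (map_zero _)]
    rfl
  · have h : ∑ δ, (Matrix.diagonal fun _ => (c : R)) γ δ • X.head δ = (c : R) • X.head γ := by
      rw [Finset.sum_eq_single γ]
      · rw [Matrix.diagonal_apply_eq]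
      · intro δ _ hδ
        rw [Matrix.diagonal_apply_ne _ hδ.symm, zero_smul]
      · simp
    rw [h, Module.algebraMap_end_apply]
    convert Submodule.zero_mem _
    exact sub_self _

lemma represents_lift {ι : Type*} (w : ι → Cen φ)
    (U : ι → (Matrix (Fin m) (Fin m) (ResidueRing R))ᵐᵒᵖ) (h : ∀ i, X.Represents (w i) (U i))
    (f : FreeAlgebra (Centre R) ι) :
    X.Represents (FreeAlgebra.lift (Centre R) w f : Cen φ)
      (FreeAlgebra.lift (Centre R) U f) := by
  induction f using FreeAlgebra.induction with
  | grade0 c =>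
    rw [AlgHom.commutes, AlgHom.commutes]
    exact X.represents_algebraMap c
  | grade1 i =>
    rw [FreeAlgebra.lift_ι_apply, FreeAlgebra.lift_ι_apply]
    exact h i
  | mul a b ha hb =>
    rw [map_mul, map_mul]
    exact ha.mul (Subtype.prop _) hb
  | add a b ha hb =>
    rw [map_add, map_add]
    exact ha.add hb

/-- The head coefficients of ψ(head γ) may be replaced by 0 at the forbidden places. If k_γ < k_δ,
then φ^(k_γ) kills ψ(head γ), so the δ-term vanishes; if k_δ = 1, the head of δ lies in ker φ. -/
lemma exists_represents (X : NilpotentJordanBase φ (Fin m)) {ψ : Module.End R M}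
    (hψ : ψ ∈ Cen φ) : ∃ U ∈ U₀op X, X.Represents ψ U := by
  classical
  have hc : ∀ γ, ∃ c : ((γ : Fin m) × Fin (X.k γ)) → R,
      ∑ p, c p • X.x p.1 p.2 = ψ (X.head γ) := fun γ =>
    (Submodule.mem_span_range_iff_exists_fun R).1 (X.span_range_eq_top ▸ Submodule.mem_top)
  choose c hc using hc
  let W : Matrix (Fin m) (Fin m) R := fun γ δ =>
    if X.k γ < X.k δ ∨ X.k δ = 1 then 0 else c γ ⟨δ, ⟨0, X.k_pos δ⟩⟩
  refine ⟨MulOpposite.op (W.map (Ideal.Quotient.mk (Ring.jacobson R))), ?_, W, rfl, fun γ => ?_⟩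
  · intro γ δ h
    rw [MulOpposite.unop_op, Matrix.map_apply, show W γ δ = 0 from if_pos h, map_zero]
  · rw [← hc γ, Fintype.sum_sigma, ← Finset.sum_sub_distrib]
    refine Submodule.sum_mem _ fun δ _ => ?_
    rw [← Finset.add_sum_erase _ _ (Finset.mem_univ (⟨0, X.k_pos δ⟩ : Fin (X.k δ))),
      add_sub_right_comm]
    refine Submodule.add_mem _ ?_ (Submodule.sum_mem _ fun i hi => Submodule.smul_mem _ _
      (X.x_mem_kerSupRange δ i fun h => (Finset.mem_erase.1 hi).1 (Fin.ext h)))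
    change c γ _ • X.head δ - W γ δ • X.head δ ∈ _
    by_cases h : X.k γ < X.k δ ∨ X.k δ = 1
    · simp only [W, if_pos h, zero_smul, sub_zero]
      obtain h | h := h
      · rw [X.smul_head_eq_zero (k := X.k γ) (c γ) _ δ h]
        · exact Submodule.zero_mem _
        · rw [hc, pow_apply_comm_of_mem_cen hψ, pow_head_eq_zero, map_zero]
      · exact Submodule.smul_mem _ _ (X.head_mem_kerSupRange h)
    · simp only [W, if_neg h, sub_self, Submodule.zero_mem]

/-- A lift of the zero matrix has entries in J, which annihilates the simple modules generated by
the heads. -/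
lemma apply_mem_of_represents_zero {ψ : Module.End R M} (hψ : ψ ∈ Cen φ)
    (h : X.Represents ψ 0) (y : M) : ψ y ∈ kerSupRange φ := by
  obtain ⟨W, hW, h⟩ := h
  have hJ : ∀ γ δ, W γ δ • X.head δ = 0 := by
    intro γ δ
    have hmem : W γ δ ∈ Ring.jacobson R :=
      Ideal.Quotient.eq_zero_iff_mem.1 (congr_fun (congr_fun hW γ) δ)
    have := X.simple δ ⟨0, X.k_pos δ⟩
    have hann := IsSemisimpleModule.jacobson_le_annihilator R
      (Submodule.span R {X.x δ ⟨0, X.k_pos δ⟩}) hmem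
    exact congr_arg Subtype.val (Module.mem_annihilator.1 hann
      ⟨X.head δ, Submodule.mem_span_singleton_self _⟩)
  have hle : (⊤ : Submodule R M) ≤ (kerSupRange φ).comap ψ := by
    rw [← X.span_range_eq_top, Submodule.span_le]
    rintro _ ⟨⟨γ, i⟩, rfl⟩
    by_cases hi : (i : ℕ) = 0
    · have := h γ
      simp only [hJ, Finset.sum_const_zero, sub_zero] at this
      obtain rfl : i = ⟨0, X.k_pos γ⟩ := Fin.ext hi
      exact this
    · exact apply_mem_kerSupRange hψ (X.x_mem_kerSupRange γ i hi)
  exact hle Submodule.mem_top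

end NilpotentJordanBase

end Module

end ZeroLevel

theorem theorem3p8 {R : Type*} [Ring R] [IsLocalRing R]
    {M : Type*} [AddCommGroup M] [Module R M] [Module.Finite R M] [IsSemisimpleModule R M]
    (φ : Module.End R M) (hφ : IsNilpotent φ) (n : ℕ) (hn : nilpotencyClass φ = n)
    {m : ℕ} (X : ZeroLevel.NilpotentJordanBase φ (Fin m)) (hX : Antitone X.k)
    {r : ℕ} (f : Fin (n - 1) → FreeAlgebra (ZeroLevel.Centre R) (Fin r))
    (hf : ∀ i, ZeroLevel.IsPolynomialIdentity (ZeroLevel.U₀op X) (f i)) :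
    ZeroLevel.IsPolynomialIdentity
      (Set.univ : Set (ZeroLevel.Cen φ ⧸ ZeroLevel.Cen₀ φ)) (List.ofFn f).prod := by
  open ZeroLevel in
  intro v _
  choose w hw using fun i => Ideal.Quotient.mk_surjective (v i)
  choose U hU hwU using fun i => X.exists_represents (w i).2
  have hlift : FreeAlgebra.lift (Centre R) v =
      (Ideal.Quotient.mkₐ (Centre R) (Cen₀ φ)).comp (FreeAlgebra.lift (Centre R) w) := by
    ext i
    simp [← hw]
  rw [hlift, AlgHom.comp_apply, Ideal.Quotient.mkₐ_eq_mk, Ideal.Quotient.eq_zero_iff_mem]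
  refine mem_Cen₀_of_mul_eq_zero (LinearMap.ext fun y => ?_)
  have hg : ∀ g ∈ (List.ofFn f).map (FreeAlgebra.lift (Centre R) w), ∀ y,
      (g : Module.End R M) y ∈ kerSupRange φ := by
    intro g hg y
    obtain ⟨p, hp, rfl⟩ := List.mem_map.1 hg
    obtain ⟨i, rfl⟩ := List.mem_ofFn.1 hp
    have h := NilpotentJordanBase.represents_lift w U hwU (f i)
    rw [hf i U hU] at h
    exact NilpotentJordanBase.apply_mem_of_represents_zero (Subtype.prop _) h y
  obtain ⟨z, hz⟩ := prod_apply_mem_range_pow _ hg y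
  -- For n = 0 the truncated n - 1 is 0, and the exponent 1 still suffices.
  have hzero : φ ^ (((List.ofFn f).map (FreeAlgebra.lift (Centre R) w)).length + 1) = 0 := by
    refine pow_eq_zero_of_le ?_ (pow_nilpotencyClass hφ)
    rw [hn, List.length_map, List.length_ofFn]
    omega
  rw [hzero] at hz
  rw [map_list_prod, Module.End.mul_apply, ← hz]
  rfl
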